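/- For a finite group $G$ with identity $e$, let the power graph $\mathcal P(G)$ be the graph with vertex set $G$ in which two distinct elements are adjacent if and only if one of them is a power of the other. Let the intersection power graph $\mathcal G_I(G)$ be the graph with vertex set $G$ in which two distinct non-identity elements $x,y$ are adjacent if and only if some non-identity element of $G$ is a power of both $x$ and $y$, and in which $e$ is adjacent to every other vertex. The difference graph $\mathcal D(G)$ is obtained from the graph on $G$ whose edges are the edges of $\mathcal G_I(G)$ that are not edges of $\mathcal P(G)$ by removing all isolated vertices. The graph with no vertices is regarded as not connected. **Theorem.** Let $G$ be a finite group such that the order of its centre $Z(G)$ has at least two distinct prime divisors. Then $\mathcal D(G)$ is connected if and only if $G$ is not isomorphic to a cyclic group $\mathbb Z_{pq}$ with $p,q$ primes. Moreover, if $\mathcal D(G)$ is connected, then $\operatorname{diam}(\mathcal D(G))\le 6$. -/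

import Mathlib

/-- The power graph of a group: distinct vertices `x` and `y` are adjacent iff one of them is a
power of the other. -/
def powerGraph (G : Type*) [Group G] : SimpleGraph G where
  Adj x y := x ≠ y ∧ (x ∈ Subgroup.zpowers y ∨ y ∈ Subgroup.zpowers x)
  symm := ⟨fun _ _ h => ⟨h.1.symm, h.2.symm⟩⟩
  loopless := ⟨fun _ h => h.1 rfl⟩

/-- The intersection power graph of a group: distinct non-identity vertices `x` and `y` are
adjacent iff some non-identity element is a power of both; the identity is adjacent to all other
vertices. -/
def intersectionPowerGraph (G : Type*) [Group G] : SimpleGraph G where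
  Adj x y := x ≠ y ∧ (x = 1 ∨ y = 1 ∨
    ∃ z : G, z ≠ 1 ∧ z ∈ Subgroup.zpowers x ∧ z ∈ Subgroup.zpowers y)
  symm := ⟨by
    rintro x y ⟨hne, h | h | ⟨z, hz, hx, hy⟩⟩
    · exact ⟨hne.symm, Or.inr (Or.inl h)⟩
    · exact ⟨hne.symm, Or.inl h⟩
    · exact ⟨hne.symm, Or.inr (Or.inr ⟨z, hz, hy, hx⟩)⟩⟩
  loopless := ⟨fun _ h => h.1 rfl⟩

/-- The undeleted difference graph: the edges of the intersection power graph that are not edges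
of the power graph, on the vertex set `G`. -/
def undeletedDifferenceGraph (G : Type*) [Group G] : SimpleGraph G :=
  intersectionPowerGraph G \ powerGraph G

/-- The difference graph: the undeleted difference graph with its isolated vertices removed
(`SimpleGraph.support` is the set of vertices that have a neighbour). -/
def differenceGraph (G : Type*) [Group G] :
    SimpleGraph (undeletedDifferenceGraph G).support :=
  (undeletedDifferenceGraph G).induce (undeletedDifferenceGraph G).support

/-! Take central elements `a`, `b` of distinct prime orders; `a * b` is a hub within distance 2 of
every non-isolated vertex `x`, so the diameter is in fact at most 4. If exactly one of `a`, `b` lies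
in `⟨x⟩`, then `x` is adjacent to the hub; otherwise `x` has a neighbour with this property
(`adj_mul_or_exists_adj_adj_mul`). The hub itself has a neighbour unless it generates `G`, in which
case `G` is cyclic of order a product of two primes. In such a group every element is trivial, of
prime order or a generator, hence isolated. -/

open Subgroup

section Cyclic

variable {G : Type*} [Group G]

/-- A non-identity power of an element of prime order generates that element. -/
theorem mem_zpowers_of_prime_orderOf {t z : G} (ht : (orderOf t).Prime)
    (hz : z ∈ zpowers t) (hz1 : z ≠ 1) : t ∈ zpowers z := by
  obtain ⟨k, rfl⟩ := mem_zpowers_iff.1 hz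
  rw [mem_zpowers_zpow_iff]
  refine (ht.coprime_iff_not_dvd.2 fun h => hz1 ?_).symm
  exact orderOf_dvd_iff_zpow_eq_one.1 (Int.natCast_dvd.2 h)

/-- A cyclic factor of coprime order is a power of the product. -/
theorem Commute.mem_zpowers_mul_of_coprime {u c : G} (h : Commute u c)
    (hc : (orderOf c).Coprime (orderOf u)) : u ∈ zpowers (u * c) := by
  have h1 : (u * c) ^ orderOf c = u ^ orderOf c := by
    rw [h.mul_pow, pow_orderOf_eq_one, mul_one]
  exact zpowers_le.2 (h1 ▸ npow_mem_zpowers (u * c) (orderOf c)) (mem_zpowers_pow_iff.2 hc)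

/-- A power of `g * c` whose order is coprime to that of `c` is a power of `g`. -/
theorem Commute.mem_zpowers_of_mem_zpowers_mul {g b c : G} (h : Commute g c)
    (hc : (orderOf c).Coprime (orderOf b)) (hb : b ∈ zpowers (g * c)) : b ∈ zpowers g := by
  obtain ⟨k, rfl⟩ := mem_zpowers_iff.1 hb
  refine zpowers_le.2 ?_ (mem_zpowers_pow_iff.2 hc)
  rw [← zpow_natCast, ← zpow_mul, h.mul_zpow, mul_comm k, zpow_mul c, zpow_natCast c,
    pow_orderOf_eq_one, one_zpow, mul_one]
  exact zpow_mem_zpowers g _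

/-- If `x` is a power of `t * c` that has `t` but not `c` among its powers, and `c` has prime
order, then `x` is a power of `t`. -/
theorem Commute.mem_zpowers_of_notMem {t c x : G} (h : Commute t c) (hc : (orderOf c).Prime)
    (ht : t ∈ zpowers x) (hcx : c ∉ zpowers x) (hx : x ∈ zpowers (t * c)) : x ∈ zpowers t := by
  obtain ⟨k, hk⟩ := mem_zpowers_iff.1 hx
  rw [h.mul_zpow] at hk
  have h1 : c ^ k ∈ zpowers x := by
    have : c ^ k = (t ^ k)⁻¹ * x := by rw [← hk, inv_mul_cancel_left]
    rw [this]
    exact mul_mem (inv_mem (zpow_mem ht k)) (mem_zpowers x)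
  have h2 : c ^ k = 1 := by
    by_contra hne
    exact hcx (zpowers_le.2 h1 (mem_zpowers_of_prime_orderOf hc (zpow_mem_zpowers c k) hne))
  rw [← hk, h2, mul_one]
  exact zpow_mem_zpowers t k

/-- An element of finite order outside a subgroup has a power of prime power order outside it. -/
theorem exists_pow_notMem_orderOf_eq_prime_pow (H : Subgroup G) {y : G} (hfin : orderOf y ≠ 0)
    (hy : y ∉ H) : ∃ u ∈ zpowers y, u ∉ H ∧ ∃ s k : ℕ, s.Prime ∧ orderOf u = s ^ k := by
  obtain ⟨n, hn⟩ : ∃ n, orderOf y = n := ⟨_, rfl⟩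
  induction n using Nat.recOnPosPrimePosCoprime generalizing y with
  | prime_pow p n hp _ => exact ⟨y, mem_zpowers y, hy, p, n, hp, hn⟩
  | zero => exact absurd hn hfin
  | one => exact absurd (orderOf_eq_one_iff.1 hn ▸ one_mem H) hy
  | coprime a b ha hb hab iha ihb =>
    have hoa : orderOf (y ^ b) = a := by
      rw [orderOf_pow_of_dvd (by lia) (hn ▸ dvd_mul_left b a), hn, Nat.mul_div_cancel _ (by lia)]
    have hob : orderOf (y ^ a) = b := by
      rw [orderOf_pow_of_dvd (by lia) (hn ▸ dvd_mul_right a b), hn,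
        Nat.mul_div_cancel_left _ (by lia)]
    -- By Bézout, `y` is a product of powers of `y ^ a` and `y ^ b`, so these cannot both lie in
    -- `H`.
    have key : y ^ b ∉ H ∨ y ^ a ∉ H := by
      by_contra! hcon
      apply hy
      have h1 : y = (y ^ a) ^ a.gcdA b * (y ^ b) ^ a.gcdB b := by
        rw [← zpow_natCast, ← zpow_natCast, ← zpow_mul, ← zpow_mul, ← zpow_add,
          ← Nat.gcd_eq_gcd_ab, hab, Nat.cast_one, zpow_one]
      rw [h1]
      exact mul_mem (zpow_mem hcon.2 _) (zpow_mem hcon.1 _)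
    rcases key with h | h
    · obtain ⟨u, hu, h'⟩ := iha (by lia) h hoa
      exact ⟨u, zpowers_le.2 (npow_mem_zpowers y b) hu, h'⟩
    · obtain ⟨u, hu, h'⟩ := ihb (by lia) h hob
      exact ⟨u, zpowers_le.2 (npow_mem_zpowers y a) hu, h'⟩

end Cyclic

section DifferenceGraph

variable {G : Type*} [Group G]

/-- The identity is a power of every element, so its edges all belong to the power graph and its
special clause disappears. -/
theorem undeletedDifferenceGraph_adj {x y : G} :
    (undeletedDifferenceGraph G).Adj x y ↔ x ∉ zpowers y ∧ y ∉ zpowers x ∧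
      ∃ z : G, z ≠ 1 ∧ z ∈ zpowers x ∧ z ∈ zpowers y := by
  simp only [undeletedDifferenceGraph, SimpleGraph.sdiff_adj, intersectionPowerGraph, powerGraph]
  constructor
  · rintro ⟨⟨hne, h⟩, h'⟩
    have h1 : x ∉ zpowers y := fun hx => h' ⟨hne, Or.inl hx⟩
    have h2 : y ∉ zpowers x := fun hy => h' ⟨hne, Or.inr hy⟩
    refine ⟨h1, h2, ?_⟩
    rcases h with rfl | rfl | h
    · exact absurd (one_mem _) h1
    · exact absurd (one_mem _) h2
    · exact h
  · rintro ⟨h1, h2, h⟩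
    exact ⟨⟨fun he => h1 (he ▸ mem_zpowers x), Or.inr (Or.inr h)⟩,
      fun h' => h'.2.elim h1 h2⟩

/-- A vertex with a neighbour is not a power of an element of prime order among its powers. -/
theorem notMem_zpowers_of_adj {x y t : G} (h : (undeletedDifferenceGraph G).Adj x y)
    (ht : (orderOf t).Prime) : x ∉ zpowers t := by
  obtain ⟨h1, -, z, hz, hzx, hzy⟩ := undeletedDifferenceGraph_adj.1 h
  intro hx
  -- The common power `z` would generate `⟨t⟩`, giving `x ∈ ⟨t⟩ = ⟨z⟩ ≤ ⟨y⟩`.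
  exact h1 (zpowers_le.2 hzy (zpowers_le.2 (mem_zpowers_of_prime_orderOf ht
    (zpowers_le.2 hx hzx) hz) hx))

theorem orderOf_ne_one_of_prime {a : G} (ha : (orderOf a).Prime) : a ≠ 1 := fun h =>
  ha.ne_one (orderOf_eq_one_iff.2 h)

/-- A vertex `x` with a neighbour is adjacent to `t * c` whenever `t`, but not `c`, is one of its
powers, where `t` and `c` are commuting elements of distinct prime orders. -/
theorem adj_mul_of_mem_of_notMem {x y t c : G} (h : (undeletedDifferenceGraph G).Adj x y)
    (htc : Commute t c) (ht : (orderOf t).Prime) (hc : (orderOf c).Prime)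
    (hne : orderOf t ≠ orderOf c) (htx : t ∈ zpowers x) (hcx : c ∉ zpowers x) :
    (undeletedDifferenceGraph G).Adj x (t * c) := by
  have hco := (Nat.coprime_primes hc ht).2 hne.symm
  refine undeletedDifferenceGraph_adj.2 ⟨fun hx => ?_, fun hx => hcx ?_, t,
    orderOf_ne_one_of_prime ht, htx, htc.mem_zpowers_mul_of_coprime hco⟩
  · exact notMem_zpowers_of_adj h ht (htc.mem_zpowers_of_notMem hc htx hcx hx)
  · refine zpowers_le.2 hx ?_
    rw [htc.eq]
    exact htc.symm.mem_zpowers_mul_of_coprime hco.symm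

/-- If `a` and `b` are powers of `x`, and `u` is an element outside `⟨x⟩` having no power equal
to `a`, where `a` is central of prime order coprime to that of `u`, then `x` has a neighbour with
exactly one of `a` and `b` among its powers. -/
theorem exists_adj_of_coprime {a b x u : G} (haZ : a ∈ center G) (ha : (orderOf a).Prime)
    (hb : (orderOf b).Prime) (hne : orderOf a ≠ orderOf b) (hax : a ∈ zpowers x)
    (hbx : b ∈ zpowers x) (hux : u ∉ zpowers x) (hco : (orderOf a).Coprime (orderOf u)) :
    ∃ v, (undeletedDifferenceGraph G).Adj x v ∧
      (a ∈ zpowers v ∧ b ∉ zpowers v ∨ b ∈ zpowers v ∧ a ∉ zpowers v) := by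
  have hua : Commute u a := mem_center_iff.1 haZ u
  have hau : a ∉ zpowers u := fun h =>
    ha.ne_one (Nat.Coprime.eq_one_of_dvd hco (orderOf_dvd_of_mem_zpowers h))
  -- If `b ∈ ⟨u⟩`, then `u` meets `⟨x⟩` in `b` and misses `a`; otherwise `u * a` gains `a` and still
  -- misses `b`.
  by_cases hbu : b ∈ zpowers u
  · exact ⟨u, undeletedDifferenceGraph_adj.2 ⟨fun h => hau (zpowers_le.2 h hax), hux, b,
      orderOf_ne_one_of_prime hb, hbx, hbu⟩, Or.inr ⟨hbu, hau⟩⟩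
  · have hav : a ∈ zpowers (u * a) := by
      rw [hua.eq]
      exact hua.symm.mem_zpowers_mul_of_coprime hco.symm
    have hbv : b ∉ zpowers (u * a) := fun h =>
      hbu (hua.mem_zpowers_of_mem_zpowers_mul ((Nat.coprime_primes ha hb).2 hne) h)
    exact ⟨u * a, undeletedDifferenceGraph_adj.2 ⟨fun h => hbv (zpowers_le.2 h hbx),
      fun h => hux ((mul_mem_cancel_right hax).1 h), a, orderOf_ne_one_of_prime ha, hax, hav⟩,
      Or.inl ⟨hav, hbv⟩⟩

variable [Finite G]

/-- If two central elements of distinct prime orders are powers of `x`, and `x` does not generate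
the group, then `x` has a neighbour with exactly one of them among its powers. -/
theorem exists_adj_of_mem_of_mem {a b x y : G} (haZ : a ∈ center G) (hbZ : b ∈ center G)
    (ha : (orderOf a).Prime) (hb : (orderOf b).Prime) (hne : orderOf a ≠ orderOf b)
    (hax : a ∈ zpowers x) (hbx : b ∈ zpowers x) (hyx : y ∉ zpowers x) :
    ∃ v, (undeletedDifferenceGraph G).Adj x v ∧
      (a ∈ zpowers v ∧ b ∉ zpowers v ∨ b ∈ zpowers v ∧ a ∉ zpowers v) := by
  obtain ⟨u, -, hux, s, k, hs, hu⟩ :=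
    exists_pow_notMem_orderOf_eq_prime_pow (zpowers x) (orderOf_pos y).ne' hyx
  -- A prime power order is coprime to that of at least one of `a`, `b`.
  by_cases hsa : s = orderOf a
  · have hco : (orderOf b).Coprime (orderOf u) := by
      rw [hu]
      exact ((Nat.coprime_primes hb hs).2 fun h => hne (hsa ▸ h.symm)).pow_right k
    obtain ⟨v, hv, h⟩ := exists_adj_of_coprime hbZ hb ha hne.symm hbx hax hux hco
    exact ⟨v, hv, h.symm⟩
  · have hco : (orderOf a).Coprime (orderOf u) := by
      rw [hu]
      exact ((Nat.coprime_primes ha hs).2 fun h => hsa h.symm).pow_right k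
    exact exists_adj_of_coprime haZ ha hb hne hax hbx hux hco

/-- Every vertex with a neighbour is at distance at most two from the product of two central
elements of distinct prime orders. -/
theorem adj_mul_or_exists_adj_adj_mul {a b x y : G} (haZ : a ∈ center G) (hbZ : b ∈ center G)
    (ha : (orderOf a).Prime) (hb : (orderOf b).Prime) (hne : orderOf a ≠ orderOf b)
    (h : (undeletedDifferenceGraph G).Adj x y) :
    (undeletedDifferenceGraph G).Adj x (a * b) ∨ ∃ v, (undeletedDifferenceGraph G).Adj x v ∧
      (undeletedDifferenceGraph G).Adj v (a * b) := by
  have hab : Commute a b := mem_center_iff.1 hbZ a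
  have one : ∀ {v w : G}, (undeletedDifferenceGraph G).Adj v w →
      (a ∈ zpowers v ∧ b ∉ zpowers v ∨ b ∈ zpowers v ∧ a ∉ zpowers v) →
      (undeletedDifferenceGraph G).Adj v (a * b) := by
    rintro v w hv (⟨h1, h2⟩ | ⟨h1, h2⟩)
    · exact adj_mul_of_mem_of_notMem hv hab ha hb hne h1 h2
    · rw [hab.eq]
      exact adj_mul_of_mem_of_notMem hv hab.symm hb ha hne.symm h1 h2
  by_cases hax : a ∈ zpowers x <;> by_cases hbx : b ∈ zpowers x
  · obtain ⟨v, hv, h'⟩ := exists_adj_of_mem_of_mem haZ hbZ ha hb hne hax hbx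
      (undeletedDifferenceGraph_adj.1 h).2.1
    exact Or.inr ⟨v, hv, one hv.symm h'⟩
  · exact Or.inl (one h (Or.inl ⟨hax, hbx⟩))
  · exact Or.inl (one h (Or.inr ⟨hbx, hax⟩))
  · have hx1 : x ≠ 1 := fun he => (undeletedDifferenceGraph_adj.1 h).1 (he ▸ one_mem _)
    have hox : orderOf x ≠ 1 := fun he => hx1 (orderOf_eq_one_iff.1 he)
    obtain ⟨r, hr, hrx⟩ := Nat.exists_prime_and_dvd hox
    obtain ⟨t, ht, htr⟩ : ∃ t ∈ zpowers x, orderOf t = r :=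
      ⟨x ^ (orderOf x / r), npow_mem_zpowers x _,
        orderOf_pow_orderOf_div (orderOf_pos x).ne' hrx⟩
    have htp : (orderOf t).Prime := htr ▸ hr
    have step : ∀ {c d : G}, c ∈ center G → (orderOf c).Prime → (orderOf d).Prime →
        orderOf c ≠ orderOf d → orderOf t ≠ orderOf c → c ∉ zpowers x → d ∉ zpowers x →
        (undeletedDifferenceGraph G).Adj x (t * c) ∧ c ∈ zpowers (t * c) ∧
          d ∉ zpowers (t * c) := by
      intro c d hcZ hc hd hcd htc hcx hdx
      have hcomm : Commute t c := mem_center_iff.1 hcZ t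
      refine ⟨adj_mul_of_mem_of_notMem h hcomm htp hc htc ht hcx, ?_, fun hmem => hdx ?_⟩
      · rw [hcomm.eq]
        exact hcomm.symm.mem_zpowers_mul_of_coprime ((Nat.coprime_primes htp hc).2 htc)
      · exact zpowers_le.2 ht
          (hcomm.mem_zpowers_of_mem_zpowers_mul ((Nat.coprime_primes hc hd).2 hcd) hmem)
    -- The order of `t` differs from that of `a` or of `b`; multiplying `t` by that element gives
    -- the middle vertex.
    by_cases hta : orderOf t = orderOf a
    · obtain ⟨h1, h2⟩ := step hbZ hb ha hne.symm (hta ▸ hne) hbx hax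
      exact Or.inr ⟨_, h1, one h1.symm (Or.inr h2)⟩
    · obtain ⟨h1, h2⟩ := step haZ ha hb hne hta hax hbx
      exact Or.inr ⟨_, h1, one h1.symm (Or.inl h2)⟩

/-- A cyclic group of order `p * q`, with `p` and `q` primes, has no edges in its difference
graph. -/
theorem not_adj_of_mulEquiv_zmod {p q : ℕ} (hp : p.Prime) (hq : q.Prime)
    (e : G ≃* Multiplicative (ZMod (p * q))) (x y : G) :
    ¬ (undeletedDifferenceGraph G).Adj x y := by
  intro h
  obtain ⟨h1, h2, z, hz, hzx, -⟩ := undeletedDifferenceGraph_adj.1 h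
  have hcard : Nat.card G = p * q := by
    rw [Nat.card_congr e.toEquiv, Nat.card_congr Multiplicative.toAdd, Nat.card_zmod]
  have hdvd : orderOf x ∣ p * q := hcard ▸ orderOf_dvd_natCard x
  have hnp : ¬ (orderOf x).Prime := fun hx => notMem_zpowers_of_adj h hx (mem_zpowers x)
  have hn1 : orderOf x ≠ 1 := fun hx => h1 (orderOf_eq_one_iff.1 hx ▸ one_mem _)
  have hpq : orderOf x ≠ p * q := fun hx => by
    have htop : zpowers x = ⊤ := by
      rw [← card_eq_iff_eq_top, Nat.card_zpowers, hx, hcard]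
    exact h2 (htop ▸ mem_top y)
  obtain ⟨d, e, hd, he, hde⟩ := (Nat.dvd_mul).1 hdvd
  rcases (Nat.dvd_prime hp).1 hd with rfl | rfl <;> rcases (Nat.dvd_prime hq).1 he with rfl | rfl
  · exact hn1 (by simpa using hde.symm)
  · exact hnp (by rw [← hde, one_mul]; exact hq)
  · exact hnp (by rw [← hde, mul_one]; exact hp)
  · exact hpq hde.symm

theorem exists_mem_center_of_prime_dvd {p : ℕ} (hp : p.Prime)
    (h : p ∣ Nat.card (center G)) : ∃ a ∈ center G, orderOf a = p := by
  have := Fact.mk hp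
  obtain ⟨a, ha⟩ := exists_prime_orderOf_dvd_card' p h
  exact ⟨a, a.2, by rw [orderOf_coe, ha]⟩

end DifferenceGraph

theorem theorem4p1 (G : Type*) [Group G] [Finite G]
    (hZ : 2 ≤ (Nat.card (Subgroup.center G)).primeFactors.card) :
    ((differenceGraph G).Connected ↔
      ¬ ∃ p q : ℕ, p.Prime ∧ q.Prime ∧ Nonempty (G ≃* Multiplicative (ZMod (p * q)))) ∧
    ((differenceGraph G).Connected → (differenceGraph G).ediam ≤ 6) := by
  obtain ⟨p, hp, q, hq, hpq⟩ := Finset.one_lt_card.1 hZ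
  have hp' := Nat.prime_of_mem_primeFactors hp
  have hq' := Nat.prime_of_mem_primeFactors hq
  obtain ⟨a, haZ, hap⟩ := exists_mem_center_of_prime_dvd hp' (Nat.dvd_of_mem_primeFactors hp)
  obtain ⟨b, hbZ, hbq⟩ := exists_mem_center_of_prime_dvd hq' (Nat.dvd_of_mem_primeFactors hq)
  have ha : (orderOf a).Prime := hap ▸ hp'
  have hb : (orderOf b).Prime := hbq ▸ hq'
  have hne : orderOf a ≠ orderOf b := by rwa [hap, hbq]
  have hab : Commute a b := mem_center_iff.1 hbZ a
  have hco := (Nat.coprime_primes ha hb).2 hne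
  -- That the hub is not isolated is part of the conclusion: it is known only once some vertex
  -- exists.
  have near : ∀ x : (undeletedDifferenceGraph G).support,
      ∃ hs : a * b ∈ (undeletedDifferenceGraph G).support,
        (differenceGraph G).edist x ⟨a * b, hs⟩ ≤ 2 := by
    rintro ⟨x, y, hxy⟩
    rcases adj_mul_or_exists_adj_adj_mul haZ hbZ ha hb hne hxy with h | ⟨v, h1, h2⟩
    · refine ⟨⟨x, h.symm⟩, ?_⟩
      exact (SimpleGraph.edist_le (SimpleGraph.Walk.cons
        (show (differenceGraph G).Adj ⟨x, _⟩ ⟨a * b, _⟩ from h) .nil)).trans (by simp)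
    · refine ⟨⟨v, h2.symm⟩, ?_⟩
      exact (SimpleGraph.edist_le (SimpleGraph.Walk.cons
        (show (differenceGraph G).Adj ⟨x, _⟩ ⟨v, ⟨x, h1.symm⟩⟩ from h1) (.cons
        (show (differenceGraph G).Adj ⟨v, _⟩ ⟨a * b, _⟩ from h2) .nil))).trans (by simp)
  have far : ∀ x y, (differenceGraph G).edist x y ≤ 4 := fun x y => by
    obtain ⟨hs, hx⟩ := near x
    obtain ⟨_, hy⟩ := near y
    rw [SimpleGraph.edist_comm] at hy
    calc (differenceGraph G).edist x y ≤ _ + _ :=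
          SimpleGraph.edist_triangle (v := ⟨a * b, hs⟩)
      _ ≤ 2 + 2 := add_le_add hx hy
      _ = 4 := by norm_num
  refine ⟨⟨?_, fun h => ?_⟩, fun _ => SimpleGraph.ediam_le_of_edist_le fun x y =>
    (far x y).trans (by norm_num)⟩
  · rintro hconn ⟨p, q, hp, hq, ⟨e⟩⟩
    obtain ⟨⟨x, y, hxy⟩⟩ := hconn.nonempty
    exact not_adj_of_mulEquiv_zmod hp hq e x y hxy
  -- Only nonemptiness remains to be shown, and an element outside `⟨a * b⟩` gives the hub a
  -- neighbour.
  · have hgen : ∃ y, y ∉ zpowers (a * b) := by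
      by_contra! hall
      have hcyc : IsCyclic G := ⟨a * b, hall⟩
      have hcard : Nat.card G = orderOf a * orderOf b := by
        rw [← hab.orderOf_mul_eq_mul_orderOf_of_coprime hco,
          orderOf_eq_card_of_forall_mem_zpowers hall]
      exact h ⟨orderOf a, orderOf b, ha, hb, ⟨hcard ▸ (zmodCyclicMulEquiv hcyc).symm⟩⟩
    obtain ⟨y, hy⟩ := hgen
    obtain ⟨v, hv, -⟩ := exists_adj_of_mem_of_mem haZ hbZ ha hb hne
      (hab.mem_zpowers_mul_of_coprime hco.symm)
      (hab.eq ▸ hab.symm.mem_zpowers_mul_of_coprime hco) hy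
    have : Nonempty (undeletedDifferenceGraph G).support := ⟨⟨a * b, v, hv⟩⟩
    refine ⟨fun x y => SimpleGraph.reachable_of_edist_ne_top fun htop => ?_⟩
    have := far x y
    rw [htop] at this
    exact absurd this (by decide)
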